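/- Consider $R\ge 1$ parallel routes between one origin and one destination. Without toll, route $r$ has travel time $c^r(x)=c^{r,\beta}x+\alpha^{r,\beta}$ for a flow $x$ in its $\beta$-th segment, where the finitely many segments $[x^{r,\beta},x^{r,\beta+1})$ (the last one being $[x^{r,\eta},\infty)$, and $x^{r,1}=0$) partition $[0,\infty)$; all slopes $c^{r,\beta}$ are positive, $\alpha^{r,1}\ge 0$, and $c^r$ is continuous. For a demand $x\in S=\{0,1,2,\dots\}$ and a toll vector $u=(u^1,\dots,u^R)$, a user equilibrium consists of flows $x^r\ge 0$ with $\sum_r x^r=x$ and a number $w$ such that $c^r(x^r)+u^r-w\ge 0$ and $x^r\,(c^r(x^r)+u^r-w)=0$ for all $r$. It exists, and the flows are unique. With $\nu=\{r: x^r=0\}$ the set of unused routes, the total system travel time is $$TSTT(x,u)=\sum_{r\in\nu}(\alpha^{r,1}+u^r)+(R-|\nu|)\,w .$$ The congestion-pricing Markov decision process has state space $S$. In state $x$ the available actions form a nonempty set $U(x)$ of vectors in $\{\tau_1,\dots,\tau_m\}^R$ (for instance all of them), where $\tau_1,\dots,\tau_m>0$ are the possible toll values. For a given constant $\theta>0$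 the transition probabilities and the expected cost per time step are $$p_{ij}(u)=e^{-\theta/TSTT(i,u)}\,\frac{\big(\theta/TSTT(i,u)\big)^j}{j!},\qquad g(i,u)=\sum_{j=0}^\infty p_{ij}(u)\,TSTT(j,u).$$ A feasible stationary policy is a map $\mu$ with $\mu(x)\in U(x)$ for all $x\in S$; its average cost from the initial state $x$ is $$J_\mu(x)=\lim_{K\to\infty}\frac1K\,E\Big\{\sum_{k=0}^{K-1}g(x_k,\mu(x_k))\,\Big|\,x_0=x\Big\}.$$ Then the series defining $g(i,u)$ converges for all $i$ and $u\in U(i)$; for every feasible stationary policy $\mu$ and every $x$ the expectations above are finite and the limit $J_\mu(x)$ exists; and there are a number $\lambda^*$ and a sequence $h^*=(h^*(0),h^*(1),\dots)$ of reals such that: 1. for every initial state $x$, the minimum of $J_\mu(x)$ over all feasible stationary policies $\mu$ is attained and equals $\lambda^*$; thus the optimal average cost exists and does not depend on the initial state; 2. Bellman's equation holds: $$h^*(i)+\lambda^*=\min_{u\in U(i)}\Big[g(i,u)+\sum_{j=0}^\infty p_{ij}(u)\,h^*(j)\Big],\qquad i=0,1,\dots,$$ where all the series converge and the minimum is attained;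 3. every feasible stationary policy $\mu$ for which $\mu(i)$ attains this minimum for all $i$ is optimal, that is, $J_\mu(x)=\min_{\mu'}J_{\mu'}(x)$ for every $x$, the minimum being over all feasible stationary policies $\mu'$. -/

import Mathlib

open Filter Topology

namespace CongestionPricing

noncomputable section

/-- A continuous, (strictly) increasing, piecewise linear travel time function on `[0, ∞)` with
`n + 1` segments. The segment `β` starts at `breakpoint β`, and there the travel time of a flow `x`
is `slope β * x + intercept β`. -/
structure RouteTime (n : ℕ) where
  breakpoint : Fin (n + 1) → ℝ
  slope : Fin (n + 1) → ℝ
  intercept : Fin (n + 1) → ℝ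
  breakpoint_zero : breakpoint 0 = 0
  breakpoint_strictMono : StrictMono breakpoint
  slope_pos : ∀ β, 0 < slope β
  /-- The travel time without any flow and toll is nonnegative. -/
  intercept_zero_nonneg : 0 ≤ intercept 0
  /-- Adjacent segments agree at their common breakpoint. -/
  continuous_at : ∀ β : Fin n,
    slope β.castSucc * breakpoint β.succ + intercept β.castSucc
      = slope β.succ * breakpoint β.succ + intercept β.succ

namespace RouteTime

variable {n : ℕ} (c : RouteTime n)

/-- The segment `β` is `[x^β, x^(β+1))`, and `[x^β, ∞)` for the last `β`. -/
def segment (β : Fin (n + 1)) : Set ℝ :=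
  {x | c.breakpoint β ≤ x ∧ ∀ γ, β < γ → x < c.breakpoint γ}

open Classical in
/-- The binary variable `z^β`. -/
def z (β : Fin (n + 1)) (x : ℝ) : ℝ := if x ∈ c.segment β then 1 else 0

/-- The travel time (without toll) at flow `x`. -/
def time (x : ℝ) : ℝ := ∑ β, (c.slope β * x + c.intercept β) * c.z β x

theorem exists_mem_segment {x : ℝ} (hx : 0 ≤ x) : ∃ β, x ∈ c.segment β := by
  classical
  have hne : (Finset.univ.filter fun β => c.breakpoint β ≤ x).Nonempty :=
    ⟨0, by simp [c.breakpoint_zero, hx]⟩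
  refine ⟨_, (Finset.mem_filter.1 (Finset.max'_mem _ hne)).2, fun γ hγ => ?_⟩
  by_contra hcon
  exact absurd (Finset.le_max' _ γ (by simpa using hcon)) (not_le.2 hγ)

theorem time_eq {x : ℝ} {β : Fin (n + 1)} (h : x ∈ c.segment β) :
    c.time x = c.slope β * x + c.intercept β := by
  have hz : ∀ γ, c.z γ x = if γ = β then 1 else 0 := by
    intro γ
    unfold z
    congr 1
    refine propext ⟨fun hγ => ?_, fun e => e ▸ h⟩
    rcases lt_trichotomy γ β with hlt | heq | hgt
    · exact absurd (hγ.2 β hlt) (not_lt.2 h.1)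
    · exact heq
    · exact absurd (h.2 γ hgt) (not_lt.2 hγ.1)
  simp [time, hz]

theorem time_zero : c.time 0 = c.intercept 0 := by
  have h : (0 : ℝ) ∈ c.segment 0 :=
    ⟨c.breakpoint_zero.le, fun γ hγ => by
      simpa [c.breakpoint_zero] using c.breakpoint_strictMono hγ⟩
  simpa using c.time_eq h

theorem breakpoint_value_strictMono :
    StrictMono fun β => c.slope β * c.breakpoint β + c.intercept β := by
  rw [Fin.strictMono_iff_lt_succ]
  intro β
  have h1 := c.continuous_at β
  have h2 := mul_lt_mul_of_pos_left (c.breakpoint_strictMono β.castSucc_lt_succ)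
    (c.slope_pos β.castSucc)
  linarith

theorem time_lt_breakpoint_value {x : ℝ} {k l : Fin (n + 1)} (hx : x ∈ c.segment k)
    (h : k < l) : c.time x < c.slope l * c.breakpoint l + c.intercept l := by
  have hk : k ≠ Fin.last n := (lt_of_lt_of_le h (Fin.le_last l)).ne
  obtain ⟨j, rfl⟩ : ∃ j : Fin n, j.castSucc = k := ⟨k.castPred hk, by simp⟩
  have h1 := c.continuous_at j
  have h2 := mul_lt_mul_of_pos_left (hx.2 _ j.castSucc_lt_succ) (c.slope_pos j.castSucc)
  have h3 := c.breakpoint_value_strictMono.monotone (Fin.castSucc_lt_iff_succ_le.1 h)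
  have h4 := c.time_eq hx
  linarith

theorem time_strictMonoOn : StrictMonoOn c.time (Set.Ici 0) := by
  intro x hx y hy hxy
  obtain ⟨k, hk⟩ := c.exists_mem_segment hx
  obtain ⟨l, hl⟩ := c.exists_mem_segment hy
  have hyl := c.time_eq hl
  rcases lt_trichotomy k l with h | rfl | h
  · have h1 := c.time_lt_breakpoint_value hk h
    have h2 := mul_le_mul_of_nonneg_left hl.1 (c.slope_pos l).le
    linarith
  · have h1 := c.time_eq hk
    have h2 := mul_lt_mul_of_pos_left hxy (c.slope_pos k)
    linarith
  · exact absurd (hl.2 k h) (not_lt.2 (hk.1.trans hxy.le))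

theorem exists_time_eq {w : ℝ} (hw : c.intercept 0 ≤ w) : ∃ x, 0 ≤ x ∧ c.time x = w := by
  classical
  have hne : (Finset.univ.filter fun β =>
      c.slope β * c.breakpoint β + c.intercept β ≤ w).Nonempty :=
    ⟨0, by simp [c.breakpoint_zero, hw]⟩
  obtain ⟨k, hkw, hk⟩ : ∃ k, c.slope k * c.breakpoint k + c.intercept k ≤ w ∧
      ∀ γ, k < γ → w < c.slope γ * c.breakpoint γ + c.intercept γ := by
    refine ⟨_, (Finset.mem_filter.1 (Finset.max'_mem _ hne)).2, fun γ hγ => ?_⟩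
    by_contra hcon
    exact absurd (Finset.le_max' _ γ (by simpa using hcon)) (not_le.2 hγ)
  have hs := c.slope_pos k
  have hb : c.breakpoint k ≤ (w - c.intercept k) / c.slope k := by
    rw [le_div_iff₀ hs]; linarith
  have hmem : (w - c.intercept k) / c.slope k ∈ c.segment k := by
    refine ⟨hb, fun γ hγ => ?_⟩
    have hkn : k ≠ Fin.last n := (lt_of_lt_of_le hγ (Fin.le_last γ)).ne
    obtain ⟨j, rfl⟩ : ∃ j : Fin n, j.castSucc = k := ⟨k.castPred hkn, by simp⟩
    refine lt_of_lt_of_le ?_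
      (c.breakpoint_strictMono.monotone (Fin.castSucc_lt_iff_succ_le.1 hγ))
    rw [div_lt_iff₀ hs]
    have h1 := c.continuous_at j
    have h2 := hk _ j.castSucc_lt_succ
    linarith
  refine ⟨(w - c.intercept k) / c.slope k, ?_, ?_⟩
  · have := c.breakpoint_strictMono.monotone (Fin.zero_le k)
    rw [c.breakpoint_zero] at this
    exact this.trans hb
  · rw [c.time_eq hmem]; field_simp; ring

/-- An increasing bijection of the real line that agrees with the travel time on `[0, ∞)`. -/
theorem exists_orderIso : ∃ e : ℝ ≃o ℝ, ∀ x, 0 ≤ x → e x = c.time x := by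
  classical
  let f : ℝ → ℝ := fun x => if 0 ≤ x then c.time x else c.intercept 0 + x
  have hge : ∀ x, 0 ≤ x → c.intercept 0 ≤ c.time x := fun x hx =>
    c.time_zero ▸ c.time_strictMonoOn.monotoneOn Set.self_mem_Ici hx hx
  have hmono : StrictMono f := by
    intro x y hxy
    simp only [f]
    split_ifs with h1 h2 h2
    · exact c.time_strictMonoOn h1 h2 hxy
    · exact absurd (h1.trans hxy.le) h2
    · have := hge y h2; linarith [not_le.1 h1]
    · linarith
  have hsurj : Function.Surjective f := by
    intro w
    rcases le_or_gt (c.intercept 0) w with h | h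
    · obtain ⟨x, hx, rfl⟩ := c.exists_time_eq h
      exact ⟨x, by simp [f, hx]⟩
    · exact ⟨w - c.intercept 0, by simp [f, not_le.2 h]⟩
  exact ⟨hmono.orderIsoOfSurjective f hsurj, fun x hx => by simp [f, hx]⟩

end RouteTime

/-- A user equilibrium (Wardrop) for demand `x` and route tolls `u`: route flows `y` and an
equilibrium travel time `w`. -/
structure IsEquilibrium {R n : ℕ} (c : Fin R → RouteTime n) (x : ℝ) (u : Fin R → ℝ)
    (y : Fin R → ℝ) (w : ℝ) : Prop where
  complementarity : ∀ r, y r * ((c r).time (y r) + u r - w) = 0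
  time_ge : ∀ r, 0 ≤ (c r).time (y r) + u r - w
  sum_flow : ∑ r, y r = x
  flow_nonneg : ∀ r, 0 ≤ y r

open Classical in
/-- `T` is the total system travel time of an equilibrium for demand `x` and tolls `u`: the sum of
the travel times of all routes, where an unused route `r` (one without flow) contributes
`α^(r,1) + u r` and each used route contributes `w`. -/
def IsTotalTime {R n : ℕ} (c : Fin R → RouteTime n) (x : ℝ) (u : Fin R → ℝ) (T : ℝ) : Prop :=
  ∃ (y : Fin R → ℝ) (w : ℝ), IsEquilibrium c x u y w ∧
    T = ∑ r ∈ Finset.univ.filter (fun r => y r = 0), ((c r).intercept 0 + u r)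
      + ((Finset.univ.filter fun r => y r ≠ 0).card : ℝ) * w

theorem exists_isEquilibrium {R n : ℕ} (hR : 0 < R) (c : Fin R → RouteTime n) {x : ℝ}
    (hx : 0 ≤ x) (u : Fin R → ℝ) : ∃ y w, IsEquilibrium c x u y w := by
  choose e he using fun r => (c r).exists_orderIso
  let y : ℝ → Fin R → ℝ := fun w r => max 0 ((e r).symm (w - u r))
  have hcont : Continuous fun w => ∑ r, y w r := by
    refine continuous_finsetSum _ fun r _ => ?_
    exact continuous_const.max ((e r).symm.continuous.comp (continuous_id.sub continuous_const))
  have hlow : ∃ w, ∑ r, y w r ≤ x := by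
    refine ⟨-∑ r, |e r 0 + u r|, ?_⟩
    rw [Finset.sum_eq_zero]
    · exact hx
    intro r _
    refine max_eq_left ?_
    rw [OrderIso.symm_apply_le]
    have h1 := Finset.single_le_sum (f := fun r => |e r 0 + u r|) (fun r _ => abs_nonneg _)
      (Finset.mem_univ r)
    have h2 := neg_abs_le (e r 0 + u r)
    linarith
  have hhigh : ∃ w, x ≤ ∑ r, y w r := by
    refine ⟨e ⟨0, hR⟩ x + u ⟨0, hR⟩, ?_⟩
    refine le_trans ?_ (Finset.single_le_sum (f := fun r => y _ r)
      (fun r _ => le_max_left _ _) (Finset.mem_univ (⟨0, hR⟩ : Fin R)))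
    simp [y]
  obtain ⟨w, hw⟩ := mem_range_of_exists_le_of_exists_ge hcont hlow hhigh
  have key : ∀ r, y w r = (e r).symm (w - u r) ∧ (c r).time (y w r) = w - u r ∨
      y w r = 0 ∧ w - u r ≤ (c r).time (y w r) := by
    intro r
    rcases le_total 0 ((e r).symm (w - u r)) with h | h
    · refine Or.inl ⟨max_eq_right h, ?_⟩
      rw [show y w r = (e r).symm (w - u r) from max_eq_right h, ← he r _ h]
      simp
    · refine Or.inr ⟨max_eq_left h, ?_⟩
      rw [show y w r = 0 from max_eq_left h, ← he r 0 le_rfl]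
      exact ((e r).symm_apply_le).1 h
  refine ⟨y w, w, fun r => ?_, fun r => ?_, hw, fun r => le_max_left _ _⟩
  · rcases key r with h | h
    · rw [h.2]; ring
    · rw [h.1]; ring
  · rcases key r with h | h <;> linarith [h.2]

theorem exists_isTotalTime {R n : ℕ} (hR : 0 < R) (c : Fin R → RouteTime n) {x : ℝ}
    (hx : 0 ≤ x) (u : Fin R → ℝ) : ∃ T, IsTotalTime c x u T := by
  obtain ⟨y, w, h⟩ := exists_isEquilibrium hR c hx u
  exact ⟨_, y, w, h, rfl⟩

/-- In an equilibrium the total time is the sum of the travel times, with tolls, of all routes. -/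
theorem IsEquilibrium.totalTime_eq {R n : ℕ} {c : Fin R → RouteTime n} {x : ℝ}
    {u y : Fin R → ℝ} {w : ℝ} (h : IsEquilibrium c x u y w)
    [DecidablePred fun r => y r = 0] [DecidablePred fun r => y r ≠ 0] :
    ∑ r ∈ Finset.univ.filter (fun r => y r = 0), ((c r).intercept 0 + u r)
      + ((Finset.univ.filter fun r => y r ≠ 0).card : ℝ) * w
      = ∑ r, ((c r).time (y r) + u r) := by
  rw [← Finset.sum_filter_add_sum_filter_not Finset.univ (fun r => y r = 0)]
  congr 1
  · refine Finset.sum_congr rfl fun r hr => ?_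
    rw [(Finset.mem_filter.1 hr).2, (c r).time_zero]
  · rw [← nsmul_eq_mul, ← Finset.sum_const]
    refine Finset.sum_congr (by ext; simp) fun r hr => ?_
    have := (mul_eq_zero.1 (h.complementarity r)).resolve_left (Finset.mem_filter.1 hr).2
    linarith

theorem IsEquilibrium.flow_unique {R n : ℕ} {c : Fin R → RouteTime n} {x : ℝ}
    {u y y' : Fin R → ℝ} {w w' : ℝ} (h : IsEquilibrium c x u y w)
    (h' : IsEquilibrium c x u y' w') : y = y' := by
  wlog hw : w ≤ w' generalizing y y' w w'
  · exact (this h' h (le_of_not_ge hw)).symm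
  have hle : ∀ r ∈ Finset.univ, y r ≤ y' r := by
    intro r _
    rcases (h.flow_nonneg r).eq_or_lt with h0 | h0
    · rw [← h0]; exact h'.flow_nonneg r
    · have h1 := (mul_eq_zero.1 (h.complementarity r)).resolve_left h0.ne'
      have h2 := h'.time_ge r
      exact ((c r).time_strictMonoOn.le_iff_le (h.flow_nonneg r) (h'.flow_nonneg r)).1
        (by linarith)
  funext r
  exact (Finset.sum_eq_sum_iff_of_le hle).1 (h.sum_flow.trans h'.sum_flow.symm) r
    (Finset.mem_univ r)

theorem IsTotalTime.unique {R n : ℕ} {c : Fin R → RouteTime n} {x : ℝ}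
    {u : Fin R → ℝ} {T T' : ℝ} (h : IsTotalTime c x u T) (h' : IsTotalTime c x u T') :
    T = T' := by
  classical
  obtain ⟨y, w, h, rfl⟩ := h
  obtain ⟨y', w', h', rfl⟩ := h'
  rw [h.totalTime_eq, h'.totalTime_eq, h.flow_unique h']

/-- The data of the day-to-day congestion pricing problem on `R` parallel routes between one
origin and one destination. -/
structure Model (R n : ℕ) where
  routes_pos : 0 < R
  /-- The travel time functions of the routes. -/
  route : Fin R → RouteTime n
  /-- The finite set of possible toll values. -/
  tolls : Finset ℝ
  tolls_pos : ∀ t ∈ tolls, 0 < t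
  /-- The set `U x` of toll vectors that are available in state `x`. -/
  U : ℕ → Set (Fin R → ℝ)
  U_nonempty : ∀ x, (U x).Nonempty
  U_tolls : ∀ x, ∀ u ∈ U x, ∀ r, u r ∈ tolls
  /-- The demand parameter. -/
  θ : ℝ
  θ_pos : 0 < θ

namespace Model

variable {R n : ℕ} (M : Model R n)

/-- The total system travel time `TSTT(x, u)` at demand `x` and toll vector `u`. -/
def TSTT (x : ℕ) (u : Fin R → ℝ) : ℝ :=
  Classical.choose (exists_isTotalTime M.routes_pos M.route (Nat.cast_nonneg (α := ℝ) x) u)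

theorem isTotalTime_TSTT (x : ℕ) (u : Fin R → ℝ) : IsTotalTime M.route x u (M.TSTT x u) :=
  Classical.choose_spec
    (exists_isTotalTime M.routes_pos M.route (Nat.cast_nonneg (α := ℝ) x) u)

/-- The transition probability from state `i` to state `j` under the toll vector `u`: the Poisson
distribution with mean `θ / TSTT(i, u)`. -/
def p (i : ℕ) (u : Fin R → ℝ) (j : ℕ) : ℝ :=
  Real.exp (-(M.θ / M.TSTT i u)) * (M.θ / M.TSTT i u) ^ j / (j.factorial : ℝ)

/-- The expected cost per time step of the toll vector `u` in state `i`. -/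
def g (i : ℕ) (u : Fin R → ℝ) : ℝ := ∑' j, M.p i u j * M.TSTT j u

/-- Feasible stationary policies. -/
def Feasible (μ : ℕ → Fin R → ℝ) : Prop := ∀ x, μ x ∈ M.U x

/-- The probability that the state is `j` at time `k` if it is `i` at time `0` and the stationary
policy `μ` is applied. -/
def pStep (μ : ℕ → Fin R → ℝ) : ℕ → ℕ → ℕ → ℝ
  | 0, i, j => if i = j then 1 else 0
  | k + 1, i, j => ∑' l, pStep μ k i l * M.p l (μ l) j

/-- The expected cost `E[g(x_k, μ(x_k)) | x_0 = x]` at time `k`. -/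
def stageCost (μ : ℕ → Fin R → ℝ) (x k : ℕ) : ℝ := ∑' j, M.pStep μ k x j * M.g j (μ j)

/-- The expected cost per time step over the first `K` time steps. -/
def meanCost (μ : ℕ → Fin R → ℝ) (x K : ℕ) : ℝ :=
  (1 / (K : ℝ)) * ∑ k ∈ Finset.range K, M.stageCost μ x k

/-- The average cost `J_μ(x)` of the stationary policy `μ` from the initial state `x`. -/
def J (μ : ℕ → Fin R → ℝ) (x : ℕ) : ℝ := limUnder atTop (M.meanCost μ x)

/-- The stationary policy `μ` is optimal from every initial state. -/
def Optimal (μ : ℕ → Fin R → ℝ) : Prop :=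
  M.Feasible μ ∧ ∀ x, ∀ ν, M.Feasible ν → M.J μ x ≤ M.J ν x

/-- The expression that is minimized in Bellman's equation. -/
def bellmanRHS (h : ℕ → ℝ) (i : ℕ) (u : Fin R → ℝ) : ℝ := M.g i u + ∑' j, M.p i u j * h j

end Model

end

end CongestionPricing

/-!
The total system travel time of an equilibrium is the sum of the tolled travel times of all routes
(`IsEquilibrium.totalTime_eq`). Hence it is bounded below by a constant `b > 0`, because every toll
is positive, and it grows at most linearly with the demand (`Model.exists_TSTT_bounds`). So the
Poisson means `θ / TSTT(i, u)` lie in `(0, θ / b]`, and this has two consequences, uniformly in the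
state `i` and the toll vector `u`: the expected cost `g(i, u)` is bounded, although the cost `TSTT`
is not, and state `0` is reached in one step with probability at least `δ = exp (-θ / b) > 0`
(`Model.exists_uniform_bounds`).

Under such a minorization, subtracting the mass `δ` at `0` from the transition probabilities leaves
a nonnegative kernel of total mass `1 - δ`, so that
`h ↦ (i ↦ min_u [g(i, u) + ∑ⱼ p_ij(u) h(j) - δ h(0)])`
is a contraction of the space of bounded functions. Its fixed point `h` solves Bellman's equation
with `λ = δ h(0)` (`exists_bellman_solution`). With one action per state the same lemma solves the
Poisson equation of a single policy. Telescoping along the Markov chain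
(`Model.sum_stageCost`) turns the Poisson equation into convergence of the average cost to the
constant of that equation (`Model.tendsto_meanCost`), and turns the inequality `≤` in Bellman's
equation, which holds for every policy, into the lower bound `λ ≤ J_μ(x)`
(`Model.le_of_tendsto_meanCost`).
-/

namespace CongestionPricing

/-! ### Expectations of bounded functions -/

/-- A probability distribution on `S`, given by its point masses. -/
structure IsDistribution {S : Type*} (π : S → ℝ) : Prop where
  nonneg : ∀ s, 0 ≤ π s
  hasSum_one : HasSum π 1

section Distribution

variable {S : Type*} {π f : S → ℝ} {C : ℝ}

theorem IsDistribution.summable_mul (hπ : IsDistribution π) (hf : ∀ s, |f s| ≤ C) :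
    Summable fun s => π s * f s := by
  refine Summable.of_norm_bounded (hπ.hasSum_one.summable.mul_right C) fun s => ?_
  rw [Real.norm_eq_abs, abs_mul, abs_of_nonneg (hπ.nonneg s)]
  exact mul_le_mul_of_nonneg_left (hf s) (hπ.nonneg s)

theorem IsDistribution.abs_tsum_mul_le (hπ : IsDistribution π) (hf : ∀ s, |f s| ≤ C) :
    |∑' s, π s * f s| ≤ C := by
  have hsum := hπ.summable_mul hf
  have hC : HasSum (fun s => π s * C) C := by simpa using hπ.hasSum_one.mul_right C
  rw [abs_le]
  constructor
  · refine hasSum_le (fun s => ?_) hC.neg hsum.hasSum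
    have := mul_le_mul_of_nonneg_left (abs_le.1 (hf s)).1 (hπ.nonneg s)
    linarith
  · exact hasSum_le
      (fun s => mul_le_mul_of_nonneg_left (abs_le.1 (hf s)).2 (hπ.nonneg s)) hsum.hasSum hC

/-- If `π` has mass at least `δ` at `s₀`, then the signed kernel `π - δ 1_{s₀}` is nonnegative of
total mass `1 - δ`. -/
theorem IsDistribution.tsum_mul_sub_le (hπ : IsDistribution π) {D δ : ℝ} {s₀ : S}
    (hδ : δ ≤ π s₀) (hfC : ∀ s, |f s| ≤ C) (hf : ∀ s, f s ≤ D) :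
    ∑' s, π s * f s - δ * f s₀ ≤ (1 - δ) * D := by
  have h1 : HasSum (fun s => π s * (D - f s)) (D - ∑' s, π s * f s) := by
    simpa [mul_sub] using (hπ.hasSum_one.mul_right D).sub (hπ.summable_mul hfC).hasSum
  have h2 : π s₀ * (D - f s₀) ≤ D - ∑' s, π s * f s :=
    le_hasSum h1 s₀ fun s _ => mul_nonneg (hπ.nonneg s) (sub_nonneg.2 (hf s))
  have h3 := mul_le_mul_of_nonneg_right hδ (sub_nonneg.2 (hf s₀))
  linarith

/-- The law of total expectation for a transition kernel `P` and a bounded function `f`. -/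
theorem IsDistribution.hasSum_bind_mul {T : Type*} {P : S → T → ℝ} {f : T → ℝ}
    (hπ : IsDistribution π) (hP : ∀ s, IsDistribution (P s)) (hf : ∀ t, |f t| ≤ C) :
    HasSum (fun t => (∑' s, π s * P s t) * f t) (∑' s, π s * ∑' t, P s t * f t) := by
  have hmass : Summable fun x : S × T => π x.1 * P x.1 x.2 := by
    have h0 : (0 : S × T → ℝ) ≤ fun x => π x.1 * P x.1 x.2 := fun x =>
      mul_nonneg (hπ.nonneg x.1) ((hP x.1).nonneg x.2)
    refine (summable_prod_of_nonneg h0).2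
      ⟨fun s => (hP s).hasSum_one.summable.mul_left (π s), ?_⟩
    simpa [tsum_mul_left, (hP _).hasSum_one.tsum_eq] using hπ.hasSum_one.summable
  have hF : Summable fun x : S × T => π x.1 * P x.1 x.2 * f x.2 := by
    refine Summable.of_norm_bounded (hmass.mul_right C) fun x => ?_
    have h0 := mul_nonneg (hπ.nonneg x.1) ((hP x.1).nonneg x.2)
    rw [Real.norm_eq_abs, abs_mul, abs_of_nonneg h0]
    exact mul_le_mul_of_nonneg_left (hf _) h0
  have hl : HasSum (fun s => π s * ∑' t, P s t * f t) (∑' x : S × T, π x.1 * P x.1 x.2 * f x.2) :=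
    hF.hasSum.prod_fiberwise fun s => by
      simpa only [mul_assoc] using ((hP s).summable_mul hf).hasSum.mul_left (π s)
  rw [hl.tsum_eq, ← (Equiv.prodComm T S).tsum_eq]
  exact hF.prod_symm.hasSum.prod_fiberwise fun t =>
    (hmass.prod_symm.prod_factor t).hasSum.mul_right (f t)

theorem IsDistribution.bind {T : Type*} {P : S → T → ℝ} (hπ : IsDistribution π)
    (hP : ∀ s, IsDistribution (P s)) : IsDistribution fun t => ∑' s, π s * P s t where
  nonneg t := tsum_nonneg fun s => mul_nonneg (hπ.nonneg s) ((hP s).nonneg t)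
  hasSum_one := by
    simpa [(hP _).hasSum_one.tsum_eq, hπ.hasSum_one.tsum_eq] using
      hπ.hasSum_bind_mul (f := fun _ => 1) (C := 1) hP (by simp)

end Distribution

/-! ### Bellman's equation under a minorization condition -/

/-- Bellman's average cost equation has a bounded solution if the costs are bounded, the action
sets are finite, and some state `s₀` is reached in one step with probability at least `δ > 0`. -/
theorem exists_bellman_solution {S A : Type*} (U : S → Set A) (hfin : ∀ s, (U s).Finite)
    (hne : ∀ s, (U s).Nonempty) (q : S → A → S → ℝ)
    (hq : ∀ s, ∀ a ∈ U s, IsDistribution (q s a)) (s₀ : S) {δ : ℝ} (hδ : 0 < δ)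
    (hmin : ∀ s, ∀ a ∈ U s, δ ≤ q s a s₀) (c : S → A → ℝ) {G : ℝ}
    (hc : ∀ s, ∀ a ∈ U s, |c s a| ≤ G) :
    ∃ (lam : ℝ) (h : S → ℝ) (C : ℝ), (∀ s, |h s| ≤ C) ∧
      ∀ s, IsLeast ((fun a => c s a + ∑' t, q s a t * h t) '' U s) (h s + lam) := by
  let _ : TopologicalSpace S := ⊥
  have _ : DiscreteTopology S := ⟨rfl⟩
  -- The term `- δ * h s₀` makes the minimum over the actions a contraction in `h`.
  let Q : (S → ℝ) → S → A → ℝ := fun h s a => c s a + ∑' t, q s a t * h t - δ * h s₀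
  have hex : ∀ (h : S → ℝ) s, ∃ a ∈ U s, ∀ b ∈ U s, Q h s a ≤ Q h s b := fun h s =>
    Set.exists_min_image (U s) (Q h s) (hfin s) (hne s)
  choose m hmU hmQ using hex
  have hbound : ∀ h : BoundedContinuousFunction S ℝ, ∀ s, |h s| ≤ ‖h‖ := fun h s =>
    h.norm_coe_le_norm s
  have hQbound : ∀ h : BoundedContinuousFunction S ℝ, ∀ s,
      ‖Q h s (m h s)‖ ≤ G + ‖h‖ + δ * ‖h‖ := by
    intro h s
    have h1 := hc s _ (hmU h s)
    have h2 := (hq s _ (hmU h s)).abs_tsum_mul_le (hbound h)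
    have h3 := mul_le_mul_of_nonneg_left (hbound h s₀) hδ.le
    rw [← abs_of_pos hδ, ← abs_mul, abs_of_pos hδ] at h3
    exact (abs_sub _ _).trans (add_le_add ((abs_add_le _ _).trans (add_le_add h1 h2)) h3)
  let T : BoundedContinuousFunction S ℝ → BoundedContinuousFunction S ℝ := fun h =>
    BoundedContinuousFunction.ofNormedAddCommGroupDiscrete (fun s => Q h s (m h s)) _ (hQbound h)
  have hTQ : ∀ h s, T h s = Q h s (m h s) := fun _ _ => rfl
  have hd : ∀ (h k : BoundedContinuousFunction S ℝ) t, |h t - k t| ≤ dist h k := fun h k t => by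
    rw [← Real.dist_eq]
    exact BoundedContinuousFunction.dist_coe_le_dist t
  have hdiff : ∀ h k s, T h s - T k s ≤ (1 - δ) * dist h k := by
    intro h k s
    -- Using the minimizer of `k` for `h` bounds `T h s` from above.
    have h1 := hmQ h s (m k s) (hmU k s)
    have hqk := hq s _ (hmU k s)
    have h2 := hqk.tsum_mul_sub_le (f := fun t => h t - k t) (C := dist h k) (D := dist h k)
      (hmin s _ (hmU k s)) (hd h k) (fun t => (le_abs_self _).trans (hd h k t))
    have h3 : ∑' t, q s (m k s) t * (h t - k t)
        = ∑' t, q s (m k s) t * h t - ∑' t, q s (m k s) t * k t := by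
      rw [← (hqk.summable_mul (hbound h)).tsum_sub (hqk.summable_mul (hbound k))]
      simp only [mul_sub]
    rw [hTQ, hTQ]
    simp only [Q] at h1 ⊢
    linarith
  have hT : ContractingWith (1 - δ).toNNReal T := by
    refine ⟨by simpa using hδ, LipschitzWith.of_dist_le_mul fun h k => ?_⟩
    have hle := mul_le_mul_of_nonneg_right (Real.le_coe_toNNReal (1 - δ)) (dist_nonneg (x := h)
      (y := k))
    refine (BoundedContinuousFunction.dist_le (by positivity)).2 fun s => ?_
    rw [Real.dist_eq, abs_le]
    have h1 := hdiff h k s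
    have h2 := hdiff k h s
    rw [dist_comm] at h2
    constructor <;> linarith
  obtain ⟨h, hh⟩ : ∃ h, T h = h := ⟨_, hT.fixedPoint_isFixedPt⟩
  refine ⟨δ * h s₀, h, ‖h‖, hbound h, fun s => ?_⟩
  have hs : Q h s (m h s) = h s := by rw [← hTQ, hh]
  simp only [Q] at hs
  refine ⟨⟨m h s, hmU h s, by simp only []; linarith⟩, ?_⟩
  rintro _ ⟨a, ha, rfl⟩
  have h1 := hmQ h s a ha
  simp only [Q] at h1 ⊢
  linarith

/-! ### Bounds on the travel times -/

theorem RouteTime.intercept_zero_le_time {n : ℕ} (c : RouteTime n) {x : ℝ} (hx : 0 ≤ x) :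
    c.intercept 0 ≤ c.time x :=
  c.time_zero ▸ c.time_strictMonoOn.monotoneOn Set.self_mem_Ici hx hx

theorem RouteTime.time_le {n : ℕ} (c : RouteTime n) {x : ℝ} (hx : 0 ≤ x) :
    c.time x ≤ ∑ β, |c.intercept β| + (∑ β, c.slope β) * x := by
  obtain ⟨β, hβ⟩ := c.exists_mem_segment hx
  rw [c.time_eq hβ]
  have h1 := Finset.single_le_sum (f := c.slope) (fun γ _ => (c.slope_pos γ).le)
    (Finset.mem_univ β)
  have h2 := Finset.single_le_sum (f := fun γ => |c.intercept γ|) (fun γ _ => abs_nonneg _)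
    (Finset.mem_univ β)
  have h3 := mul_le_mul_of_nonneg_right h1 hx
  have h4 := le_abs_self (c.intercept β)
  linarith

theorem hasSum_pow_div_factorial (m : ℝ) :
    HasSum (fun j : ℕ => m ^ j / (j.factorial : ℝ)) (Real.exp m) := by
  rw [Real.exp_eq_exp_ℝ]
  exact NormedSpace.expSeries_div_hasSum_exp m

namespace Model

variable {R n : ℕ} (M : Model R n)

theorem U_finite (x : ℕ) : (M.U x).Finite := by
  refine (Set.Finite.pi' fun _ : Fin R => M.tolls.finite_toSet).subset fun u hu => ?_
  exact fun r => M.U_tolls x u hu r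

/-- The total system travel time is bounded away from zero and grows at most linearly. -/
theorem exists_TSTT_bounds : ∃ b > 0, ∃ A B : ℝ, 0 ≤ A ∧ 0 ≤ B ∧
    ∀ (x : ℕ) (u : Fin R → ℝ), (∀ r, u r ∈ M.tolls) → b ≤ M.TSTT x u ∧ M.TSTT x u ≤ A + B * x := by
  classical
  have hR : Nonempty (Fin R) := ⟨⟨0, M.routes_pos⟩⟩
  obtain ⟨u₀, hu₀⟩ := M.U_nonempty 0
  have htne : M.tolls.Nonempty := ⟨_, M.U_tolls 0 u₀ hu₀ (Classical.arbitrary _)⟩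
  have hmin := M.tolls_pos _ (M.tolls.min'_mem htne)
  have hmax := M.tolls_pos _ (M.tolls.max'_mem htne)
  refine ⟨M.tolls.min' htne, hmin,
    ∑ r, (∑ β, |(M.route r).intercept β| + M.tolls.max' htne), ∑ r, ∑ β, (M.route r).slope β,
    by positivity, Finset.sum_nonneg fun r _ => Finset.sum_nonneg fun β _ =>
      ((M.route r).slope_pos β).le, fun x u hu => ?_⟩
  obtain ⟨y, w, he, hT⟩ := M.isTotalTime_TSTT x u
  rw [hT, he.totalTime_eq]
  have hlow : ∀ r, M.tolls.min' htne ≤ (M.route r).time (y r) + u r := fun r => by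
    have h1 := (M.route r).intercept_zero_le_time (he.flow_nonneg r)
    have h2 := (M.route r).intercept_zero_nonneg
    have h3 := M.tolls.min'_le _ (hu r)
    linarith
  constructor
  · exact (hlow (Classical.arbitrary _)).trans
      (Finset.single_le_sum (f := fun r => (M.route r).time (y r) + u r)
        (fun r _ => hmin.le.trans (hlow r)) (Finset.mem_univ _))
  · rw [Finset.sum_mul, ← Finset.sum_add_distrib]
    refine Finset.sum_le_sum fun r _ => ?_
    have h1 := (M.route r).time_le (he.flow_nonneg r)
    have h2 := M.tolls.le_max' _ (hu r)
    have h3 : y r ≤ x := he.sum_flow ▸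
      Finset.single_le_sum (fun r _ => he.flow_nonneg r) (Finset.mem_univ r)
    have h4 := mul_le_mul_of_nonneg_left h3
      (Finset.sum_nonneg (s := Finset.univ) fun β _ => ((M.route r).slope_pos β).le)
    linarith

/-- Uniformly over states and actions, the transition probabilities are distributions with mass at
least `δ > 0` at state `0`, and the expected cost is bounded. -/
theorem exists_uniform_bounds : ∃ δ > 0, ∃ G : ℝ, ∀ i, ∀ u ∈ M.U i,
    IsDistribution (M.p i u) ∧ δ ≤ M.p i u 0 ∧
      (Summable fun j => M.p i u j * M.TSTT j u) ∧ |M.g i u| ≤ G := by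
  obtain ⟨b, hb, A, B, hA, hB, hT⟩ := M.exists_TSTT_bounds
  refine ⟨Real.exp (-(M.θ / b)), Real.exp_pos _, A + B * Real.exp (M.θ / b), fun i u hu => ?_⟩
  have hu' := M.U_tolls i u hu
  have hbi := (hT i u hu').1
  set m := M.θ / M.TSTT i u with hm
  have hm0 : 0 ≤ m := div_nonneg M.θ_pos.le (hb.le.trans hbi)
  have hmb : m ≤ M.θ / b := div_le_div_of_nonneg_left M.θ_pos.le hb hbi
  have hp : ∀ j, M.p i u j = Real.exp (-m) * (m ^ j / (j.factorial : ℝ)) := fun j => by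
    rw [p, mul_div_assoc]
  have hp0 : ∀ j, 0 ≤ M.p i u j := fun j => by rw [hp]; positivity
  have hp1 : HasSum (M.p i u) 1 := by
    have := (hasSum_pow_div_factorial m).mul_left (Real.exp (-m))
    rw [← Real.exp_add, neg_add_cancel, Real.exp_zero] at this
    exact this.congr_fun hp
  -- The bound `j ≤ 2 ^ j` reduces the first moment to another exponential series.
  have hp2 : HasSum (fun j => M.p i u j * 2 ^ j) (Real.exp m) := by
    have := (hasSum_pow_div_factorial (2 * m)).mul_left (Real.exp (-m))
    rw [← Real.exp_add, show -m + 2 * m = m by ring] at this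
    refine this.congr_fun fun j => ?_
    rw [hp, mul_pow]
    ring
  have hmaj := (hp1.mul_right A).add (hp2.mul_left B)
  have hnn : ∀ j, 0 ≤ M.p i u j * M.TSTT j u := fun j =>
    mul_nonneg (hp0 j) (hb.le.trans (hT j u hu').1)
  have hle : ∀ j, M.p i u j * M.TSTT j u ≤ M.p i u j * A + B * (M.p i u j * 2 ^ j) := by
    intro j
    have hj : (j : ℝ) ≤ 2 ^ j := by exact_mod_cast j.lt_two_pow_self.le
    have h1 := (hT j u hu').2.trans (add_le_add_right (mul_le_mul_of_nonneg_left hj hB) A)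
    refine (mul_le_mul_of_nonneg_left h1 (hp0 j)).trans_eq (by ring)
  have hsum : Summable fun j => M.p i u j * M.TSTT j u :=
    Summable.of_nonneg_of_le hnn hle hmaj.summable
  refine ⟨⟨hp0, hp1⟩, ?_, hsum, ?_⟩
  · rw [hp]
    simpa using hmb
  · rw [g, abs_of_nonneg (tsum_nonneg hnn)]
    refine (hasSum_le hle hsum.hasSum hmaj).trans ?_
    have := mul_le_mul_of_nonneg_left (Real.exp_le_exp.2 hmb) hB
    linarith

theorem isDistribution_p {i : ℕ} {u : Fin R → ℝ} (hu : u ∈ M.U i) : IsDistribution (M.p i u) := by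
  obtain ⟨_, _, _, h⟩ := M.exists_uniform_bounds
  exact (h i u hu).1

theorem exists_abs_g_le : ∃ G : ℝ, ∀ i, ∀ u ∈ M.U i, |M.g i u| ≤ G := by
  obtain ⟨_, _, G, h⟩ := M.exists_uniform_bounds
  exact ⟨G, fun i u hu => (h i u hu).2.2.2⟩

/-! ### Average cost of a stationary policy -/

variable {M} {μ : ℕ → Fin R → ℝ}

theorem Feasible.isDistribution_pStep (hμ : M.Feasible μ) (k x : ℕ) :
    IsDistribution (M.pStep μ k x) := by
  induction k with
  | zero =>
    refine ⟨fun j => ?_, ?_⟩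
    · rw [pStep]
      split_ifs <;> norm_num
    · simpa [pStep] using hasSum_ite_eq' x (1 : ℝ)
  | succ k ih => exact ih.bind fun l => M.isDistribution_p (hμ l)

/-- The tower property of the chain: conditioning on the state at time `k`. -/
theorem Feasible.tsum_pStep_succ (hμ : M.Feasible μ) {f : ℕ → ℝ} {C : ℝ} (hf : ∀ i, |f i| ≤ C)
    (k x : ℕ) : ∑' j, M.pStep μ (k + 1) x j * f j
      = ∑' l, M.pStep μ k x l * ∑' j, M.p l (μ l) j * f j :=
  ((hμ.isDistribution_pStep k x).hasSum_bind_mul (fun l => M.isDistribution_p (hμ l)) hf).tsum_eq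

/-- Telescoping along the chain: the total cost is the accumulated expectation of the Bellman
residual `g + P h - h`, up to boundary terms in `h`. -/
theorem sum_stageCost (hμ : M.Feasible μ) {h : ℕ → ℝ} {C : ℝ} (hh : ∀ i, |h i| ≤ C) (x K : ℕ) :
    ∑ k ∈ Finset.range K, M.stageCost μ x k
      = ∑ k ∈ Finset.range K, ∑' j, M.pStep μ k x j * (M.bellmanRHS h j (μ j) - h j)
        + (∑' j, M.pStep μ 0 x j * h j - ∑' j, M.pStep μ K x j * h j) := by
  obtain ⟨G, hG⟩ := M.exists_abs_g_le
  rw [← Finset.sum_range_sub' (fun k => ∑' j, M.pStep μ k x j * h j), ← Finset.sum_add_distrib]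
  refine Finset.sum_congr rfl fun k _ => ?_
  have hd := hμ.isDistribution_pStep k x
  have hg := hd.summable_mul (fun j => hG j _ (hμ j))
  have hP := hd.summable_mul fun j => (M.isDistribution_p (hμ j)).abs_tsum_mul_le hh
  have hk := hd.summable_mul hh
  have hsplit : ∑' j, M.pStep μ k x j * (M.bellmanRHS h j (μ j) - h j)
      = M.stageCost μ x k + ∑' j, M.pStep μ k x j * ∑' l, M.p j (μ j) l * h l
        - ∑' j, M.pStep μ k x j * h j := by
    rw [stageCost, ← hg.tsum_add hP, ← (hg.add hP).tsum_sub hk]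
    simp only [bellmanRHS, mul_sub, mul_add]
  rw [hsplit, hμ.tsum_pStep_succ hh]
  ring

/-- Up to an error `O(1 / K)`, the mean cost is the mean of the expected Bellman residuals. -/
theorem Feasible.abs_meanCost_sub_le (hμ : M.Feasible μ) {h : ℕ → ℝ} {C : ℝ}
    (hh : ∀ i, |h i| ≤ C) (x K : ℕ) :
    |M.meanCost μ x K - (1 / (K : ℝ)) * ∑ k ∈ Finset.range K,
      ∑' j, M.pStep μ k x j * (M.bellmanRHS h j (μ j) - h j)| ≤ 2 * C / K := by
  rw [meanCost, sum_stageCost hμ hh, ← mul_sub, add_sub_cancel_left, abs_mul,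
    abs_of_nonneg (by positivity), one_div, inv_mul_eq_div]
  gcongr
  have h0 := (hμ.isDistribution_pStep 0 x).abs_tsum_mul_le hh
  have hK := (hμ.isDistribution_pStep K x).abs_tsum_mul_le hh
  exact (abs_sub _ _).trans (by linarith)

/-- A bounded solution of the Poisson equation of a policy yields its average cost. -/
theorem tendsto_meanCost (hμ : M.Feasible μ) {lam : ℝ} {h : ℕ → ℝ} {C : ℝ}
    (hh : ∀ i, |h i| ≤ C) (heq : ∀ i, M.bellmanRHS h i (μ i) = h i + lam) (x : ℕ) :
    Tendsto (M.meanCost μ x) atTop (𝓝 lam) := by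
  rw [tendsto_iff_dist_tendsto_zero]
  refine squeeze_zero' (.of_forall fun _ => dist_nonneg) ?_
    (tendsto_const_div_atTop_nhds_zero_nat (2 * C))
  filter_upwards [eventually_gt_atTop 0] with K hK
  have hK' : (K : ℝ) ≠ 0 := by positivity
  have := hμ.abs_meanCost_sub_le hh x K
  simp only [heq, add_sub_cancel_left, tsum_mul_right,
    (hμ.isDistribution_pStep _ x).hasSum_one.tsum_eq, one_mul, Finset.sum_const,
    Finset.card_range, nsmul_eq_mul] at this
  rwa [one_div, inv_mul_cancel_left₀ hK', ← Real.dist_eq] at this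

/-- A subsolution of Bellman's equation bounds the average cost of the policy from below. -/
theorem le_of_tendsto_meanCost (hμ : M.Feasible μ) {lam a : ℝ} {h : ℕ → ℝ} {C : ℝ}
    (hh : ∀ i, |h i| ≤ C) (hle : ∀ i, h i + lam ≤ M.bellmanRHS h i (μ i)) {x : ℕ}
    (ha : Tendsto (M.meanCost μ x) atTop (𝓝 a)) : lam ≤ a := by
  obtain ⟨G, hG⟩ := M.exists_abs_g_le
  have hlim : Tendsto (fun K : ℕ => M.meanCost μ x K + 2 * C / K) atTop (𝓝 a) := by
    simpa using ha.add (tendsto_const_div_atTop_nhds_zero_nat (2 * C))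
  refine ge_of_tendsto hlim ?_
  filter_upwards [eventually_gt_atTop 0] with K hK
  have hres : ∀ j, |M.bellmanRHS h j (μ j) - h j| ≤ G + C + C := fun j =>
    (abs_sub _ _).trans (add_le_add ((abs_add_le _ _).trans (add_le_add (hG j _ (hμ j))
      ((M.isDistribution_p (hμ j)).abs_tsum_mul_le hh))) (hh j))
  have hE : ∀ k, lam ≤ ∑' j, M.pStep μ k x j * (M.bellmanRHS h j (μ j) - h j) := by
    intro k
    have hd := hμ.isDistribution_pStep k x
    have h1 : HasSum (fun j => M.pStep μ k x j * lam) lam := by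
      simpa using hd.hasSum_one.mul_right lam
    exact hasSum_le (fun j => mul_le_mul_of_nonneg_left (by linarith [hle j]) (hd.nonneg j)) h1
      (hd.summable_mul hres).hasSum
  have hS := Finset.card_nsmul_le_sum (Finset.range K) _ lam fun k _ => hE k
  rw [Finset.card_range, nsmul_eq_mul] at hS
  have hK' : (0 : ℝ) < K := by positivity
  have h2 : lam ≤ (1 / (K : ℝ)) * ∑ k ∈ Finset.range K,
      ∑' j, M.pStep μ k x j * (M.bellmanRHS h j (μ j) - h j) := by
    rwa [one_div, inv_mul_eq_div, le_div_iff₀' hK']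
  have h3 := (abs_le.1 (hμ.abs_meanCost_sub_le hh x K)).1
  linarith

theorem J_eq_of_tendsto {x : ℕ} {a : ℝ} (h : Tendsto (M.meanCost μ x) atTop (𝓝 a)) :
    M.J μ x = a :=
  h.limUnder_eq

/-- Each policy solves a Poisson equation, so that its average cost is a limit. -/
theorem Feasible.tendsto_meanCost_J (hμ : M.Feasible μ) (x : ℕ) :
    Tendsto (M.meanCost μ x) atTop (𝓝 (M.J μ x)) := by
  obtain ⟨δ, hδ, G, hG⟩ := M.exists_uniform_bounds
  obtain ⟨lam, h, C, hh, hmin⟩ := exists_bellman_solution (fun i => {μ i})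
    (fun i => Set.finite_singleton _) (fun i => Set.singleton_nonempty _) M.p
    (by rintro i _ rfl; exact (hG i _ (hμ i)).1) 0 hδ
    (by rintro i _ rfl; exact (hG i _ (hμ i)).2.1) M.g
    (by rintro i _ rfl; exact (hG i _ (hμ i)).2.2.2)
  have hlim := tendsto_meanCost hμ hh (lam := lam) (fun i => by
    obtain ⟨_, rfl, hu⟩ := (hmin i).1
    exact hu) x
  rwa [J_eq_of_tendsto hlim]

end Model

end CongestionPricing

theorem mainTheorem5 {R n : ℕ} (M : CongestionPricing.Model R n) :
    -- the expected costs are finite and the average cost of each policy is a genuine limit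
    (∀ i, ∀ u ∈ M.U i, Summable fun j => M.p i u j * M.TSTT j u) ∧
    (∀ μ, M.Feasible μ → ∀ x,
      (∀ k, Summable fun j => M.pStep μ k x j * M.g j (μ j)) ∧
      Tendsto (M.meanCost μ x) atTop (𝓝 (M.J μ x))) ∧
    ∃ (lam : ℝ) (h : ℕ → ℝ),
      -- the optimal average cost exists and is the same for all initial states
      (∀ x, IsLeast {a | ∃ μ, M.Feasible μ ∧ a = M.J μ x} lam) ∧
      -- Bellman's equation
      (∀ i, ∀ u ∈ M.U i, Summable fun j => M.p i u j * h j) ∧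
      (∀ i, IsLeast (M.bellmanRHS h i '' M.U i) (h i + lam)) ∧
      -- a stationary policy that attains the minimum in every state is optimal
      (∀ μ, M.Feasible μ → (∀ i, IsLeast (M.bellmanRHS h i '' M.U i) (M.bellmanRHS h i (μ i))) →
        M.Optimal μ) := by
  obtain ⟨δ, hδ, G, hG⟩ := M.exists_uniform_bounds
  obtain ⟨lam, h, C, hh, hmin⟩ := CongestionPricing.exists_bellman_solution M.U M.U_finite
    M.U_nonempty M.p (fun i u hu => (hG i u hu).1) 0 hδ (fun i u hu => (hG i u hu).2.1) M.g
    (fun i u hu => (hG i u hu).2.2.2)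
  have hlow : ∀ μ, M.Feasible μ → ∀ x, lam ≤ M.J μ x := fun μ hμ x =>
    CongestionPricing.Model.le_of_tendsto_meanCost hμ hh
      (fun i => (hmin i).2 ⟨μ i, hμ i, rfl⟩) (hμ.tendsto_meanCost_J x)
  have hJ : ∀ μ, M.Feasible μ → (∀ i, M.bellmanRHS h i (μ i) = h i + lam) → ∀ x, M.J μ x = lam :=
    fun μ hμ heq x => CongestionPricing.Model.J_eq_of_tendsto
      (CongestionPricing.Model.tendsto_meanCost hμ hh heq x)
  refine ⟨fun i u hu => (hG i u hu).2.2.1, fun μ hμ x => ⟨fun k => ?_, hμ.tendsto_meanCost_J x⟩,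
    lam, h, fun x => ⟨?_, ?_⟩, fun i u hu => (hG i u hu).1.summable_mul hh, hmin,
    fun μ hμ hatt => ⟨hμ, fun x ν hν => ?_⟩⟩
  · exact (hμ.isDistribution_pStep k x).summable_mul fun j => (hG j _ (hμ j)).2.2.2
  · choose μ hμ heq using fun i => (hmin i).1
    exact ⟨μ, hμ, (hJ μ hμ heq x).symm⟩
  · rintro _ ⟨μ, hμ, rfl⟩
    exact hlow μ hμ x
  · rw [hJ μ hμ (fun i => (hatt i).unique (hmin i)) x]
    exact hlow ν hν x
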